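/- For ordinals $\lambda,\mu$, a complete Boolean algebra $\mathbb{B}$ is called $(\lambda,\mu)$-distributive if $$\prod_{\alpha<\lambda}\sum_{\beta<\mu}u_{\alpha,\beta}=\sum_{f:\lambda\to\mu}\ \prod_{\alpha<\lambda}u_{\alpha,f(\alpha)}$$ for every family $\langle u_{\alpha,\beta}\in\mathbb{B}:\alpha<\lambda,\ \beta<\mu\rangle$. Let $[\omega]^\omega$ be the set of infinite subsets of $\omega$, and for $S,T\in[\omega]^\omega$ write $S\subseteq^* T$ (equivalently $T\supseteq^* S$) if $S\setminus T$ is finite. The tower number $\mathfrak{t}$ is the smallest length of a sequence $\langle S_\alpha : \alpha<\delta\rangle$ of elements of $[\omega]^\omega$ ($\delta$ an ordinal) such that $S_\alpha\supseteq^* S_\beta$ for all $\alpha<\beta<\delta$, but there is no $S\in[\omega]^\omega$ with $S_\alpha\supseteq^* S$ for all $\alpha<\delta$. Let $\kappa$ be an infinite cardinal. Let $\mathbb{B}$ be a complete Boolean algebra such that $\mathbb{B}$ is $(\omega,2)$-distributive and $1\Vdash_{\mathbb{B}}\check\kappa<\mathfrak{t}$; that is, the statement "$\check\kappa<\mathfrak{t}$",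 with $\mathfrak{t}$ interpreted in the Boolean-valued universe $V^{\mathbb{B}}$ and $\check\kappa$ the canonical name of $\kappa$, has Boolean value $1$. Then $\mathbb{B}$ is $(\kappa,2)$-distributive. -/

import Mathlib

universe u

/-- `(lam, kap)`-distributivity of a complete Boolean algebra, for ordinals `lam` and `kap`:
`∏_{α < lam} ∑_{β < kap} u_{α,β} = ∑_{f : lam → kap} ∏_{α < lam} u_{α,f(α)}`. -/
def IsDistributive (B : Type u) [CompleteBooleanAlgebra B] (lam kap : Ordinal.{u}) : Prop :=
  ∀ v : Set.Iio lam → Set.Iio kap → B,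
    (⨅ α, ⨆ β, v α β) = ⨆ f : Set.Iio lam → Set.Iio kap, ⨅ α, v α (f α)

/-- The Boolean-valued universe `V^B`, i.e. the class of `B`-names: a name is a (small) family of
names together with a Boolean value attached to each member of the family. -/
inductive BVSet (B : Type u) : Type (u + 1)
  | mk (ι : Type u) (A : ι → BVSet B) (b : ι → B) : BVSet B

namespace BVSet

/-- The index type of a name. -/
def Idx {B : Type u} : BVSet B → Type u
  | mk ι _ _ => ι

/-- The names occurring in a name. -/
def fam {B : Type u} : (x : BVSet B) → x.Idx → BVSet B
  | mk _ A _ => A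

/-- The Boolean values attached to the names occurring in a name. -/
def val {B : Type u} : (x : BVSet B) → x.Idx → B
  | mk _ _ b => b

/-- The canonical name `x̌` of a set `x` of the ground model. -/
def check (B : Type u) [CompleteBooleanAlgebra B] : PSet.{u} → BVSet B
  | ⟨ι, A⟩ => mk ι (fun i => check B (A i)) (fun _ => ⊤)

variable {B : Type u} [CompleteBooleanAlgebra B]

/-- The Boolean value `⟦x = y⟧`. -/
def beq : BVSet B → BVSet B → B
  | mk ι A b, mk ι' A' b' =>
    (⨅ i : ι, b i ⇨ (⨆ j : ι', b' j ⊓ beq (A i) (A' j))) ⊓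
      (⨅ j : ι', b' j ⇨ (⨆ i : ι, b i ⊓ beq (A i) (A' j)))

/-- The Boolean value `⟦x ∈ y⟧`. -/
def bmem (x y : BVSet B) : B :=
  ⨆ i : y.Idx, y.val i ⊓ beq x (y.fam i)

end BVSet

infix:75 " =ᴮ " => BVSet.beq
infix:75 " ∈ᴮ " => BVSet.bmem

/-!
Below, formulas of the language of set theory are interpreted in `V^B` in the standard way:
conjunction, disjunction, implication and negation are `⊓`, `⊔`, `⇨` and `ᶜ`, the quantifiers
`∀ x` and `∃ x` are `⨅ x : BVSet B` and `⨆ x : BVSet B`. A definition with values in `B`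
is the Boolean value of the formula described in its documentation. -/

namespace BVSet

variable {B : Type u} [CompleteBooleanAlgebra B]

/-- The condition `p` forces a statement with Boolean value `φ`, that is, `p ≤ φ`. -/
def Forces (p φ : B) : Prop := p ≤ φ

/-- The canonical name of (the von Neumann ordinal) `ω`. -/
noncomputable def omega (B : Type u) [CompleteBooleanAlgebra B] : BVSet B :=
  check B (Ordinal.toPSet Ordinal.omega0)

/-- A name for the unordered pair `{x, y}`. -/
def upair (x y : BVSet B) : BVSet B :=
  mk (ULift.{u} Bool) (fun i => bif i.down then x else y) (fun _ => ⊤)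

/-- A name for the ordered pair `⟨x, y⟩ = {{x}, {x, y}}`. -/
def opair (x y : BVSet B) : BVSet B :=
  upair (upair x x) (upair x y)

/-- A name for the difference `x - y`. -/
def diff (x y : BVSet B) : BVSet B :=
  mk x.Idx x.fam (fun i => x.val i ⊓ (x.fam i ∈ᴮ y)ᶜ)

/-- `x ⊆ y`. -/
def bsubset (x y : BVSet B) : B :=
  ⨅ z : BVSet B, z ∈ᴮ x ⇨ z ∈ᴮ y

/-- `x` is transitive. -/
def isTransitive (x : BVSet B) : B :=
  ⨅ y : BVSet B, y ∈ᴮ x ⇨ bsubset y x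

/-- `x` is an ordinal, that is, a transitive set of transitive sets. -/
def isOrdinal (x : BVSet B) : B :=
  isTransitive x ⊓ (⨅ y : BVSet B, y ∈ᴮ x ⇨ isTransitive y)

/-- `f` is a function with domain `d`. -/
def isFunOn (f d : BVSet B) : B :=
  (⨅ p : BVSet B, p ∈ᴮ f ⇨ (⨆ x : BVSet B, ⨆ y : BVSet B, x ∈ᴮ d ⊓ p =ᴮ opair x y)) ⊓
  (⨅ x : BVSet B, x ∈ᴮ d ⇨ (⨆ y : BVSet B, opair x y ∈ᴮ f)) ⊓
  (⨅ x : BVSet B, ⨅ y : BVSet B, ⨅ z : BVSet B,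
    (opair x y ∈ᴮ f ⊓ opair x z ∈ᴮ f) ⇨ y =ᴮ z)

/-- `x` is finite, that is, `x` is the range of a function whose domain is a natural number. -/
noncomputable def isFinite (x : BVSet B) : B :=
  ⨆ n : BVSet B, ⨆ f : BVSet B, n ∈ᴮ omega B ⊓ isFunOn f n ⊓
    (⨅ y : BVSet B, (y ∈ᴮ x ⇨ (⨆ i : BVSet B, opair i y ∈ᴮ f)) ⊓
      ((⨆ i : BVSet B, opair i y ∈ᴮ f) ⇨ y ∈ᴮ x))

/-- `S ∈ [ω]^ω`, that is, `S` is an infinite subset of `ω`. -/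
noncomputable def isInfSubsetOmega (S : BVSet B) : B :=
  bsubset S (omega B) ⊓ (isFinite S)ᶜ

/-- `S ⊆* T`, that is, `S - T` is finite. -/
noncomputable def almostSubset (S T : BVSet B) : B :=
  isFinite (diff S T)

/-- `s = ⟨S_α : α < d⟩` is a sequence of elements of `[ω]^ω` such that `S_α ⊇* S_β` for all
`α < β < d`. -/
noncomputable def isDecreasingSeq (s d : BVSet B) : B :=
  isFunOn s d ⊓
  (⨅ α : BVSet B, ⨅ S : BVSet B, opair α S ∈ᴮ s ⇨ isInfSubsetOmega S) ⊓
  (⨅ α : BVSet B, ⨅ β : BVSet B, ⨅ S : BVSet B, ⨅ T : BVSet B,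
    (α ∈ᴮ β ⊓ opair α S ∈ᴮ s ⊓ opair β T ∈ᴮ s) ⇨ almostSubset T S)

/-- There is `S ∈ [ω]^ω` such that `S_α ⊇* S` for every term `S_α` of the sequence `s`. -/
noncomputable def hasPseudoIntersection (s : BVSet B) : B :=
  ⨆ S : BVSet B, isInfSubsetOmega S ⊓
    (⨅ α : BVSet B, ⨅ T : BVSet B, opair α T ∈ᴮ s ⇨ almostSubset S T)

/-- `d` is an ordinal and it is the length of a `⊇*`-decreasing sequence in `[ω]^ω` without
pseudo-intersection in `[ω]^ω`. -/
noncomputable def isTowerLength (d : BVSet B) : B :=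
  isOrdinal d ⊓ (⨆ s : BVSet B, isDecreasingSeq s d ⊓ (hasPseudoIntersection s)ᶜ)

/-- `t` is the tower number `𝔱`, the least tower length. -/
noncomputable def isTowerNumber (t : BVSet B) : B :=
  isTowerLength t ⊓ (⨅ d : BVSet B, isTowerLength d ⇨ (t =ᴮ d ⊔ t ∈ᴮ d))

/-- `x < 𝔱`, that is, `x` is an element of the ordinal `𝔱`. -/
noncomputable def ltTowerNumber (x : BVSet B) : B :=
  ⨆ t : BVSet B, isTowerNumber t ⊓ x ∈ᴮ t

end BVSet

/-! Fix in the ground model a binary tree of infinite sets of naturals, decreasing under `⊇*` along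
branches, in which every branch set splits into two disjoint infinite halves, one for each
successor. A family of `κ` elements of `B` names a branch of this tree in `V^B`: at each level the
half is chosen by whether the element or its complement holds. The sets along this branch form a
`⊇*`-decreasing sequence of length at most `κ < 𝔱`, so they have a pseudo-intersection in `V^B`. It
is a subset of `ω`, so by `(ω,2)`-distributivity it equals a ground-model set `A` below some
condition. Sets at incomparable nodes are almost disjoint, so `A` determines the branch, and that
condition decides the whole family.

Two points need care. The tree must not break off at a limit level: the canonical name of a
ground-model sequence also has a pseudo-intersection in `V^B`, hence one in the ground model
(`branchSet_spec`). And the nodes passed by the named branch must lie in the ground model, which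
requires its proper initial segments to be decided densely often; so `exists_decided` is an
induction on length. Both uses of `κ < 𝔱` go through `exists_infinite_almost_subset`. -/

namespace BVSet

/-! ### Forcing calculus in a complete Boolean algebra -/

section Forcing

variable {B : Type u} [CompleteBooleanAlgebra B] {p a b c : B}

theorem or_elim (h : p ≤ a ⊔ b) (ha : ∀ q ≤ p, q ≤ a → q ≤ c) (hb : ∀ q ≤ p, q ≤ b → q ≤ c) :
    p ≤ c := by
  calc p = p ⊓ a ⊔ p ⊓ b := by rw [← inf_sup_left, inf_eq_left.2 h]
    _ ≤ c := sup_le (ha _ inf_le_left inf_le_right) (hb _ inf_le_left inf_le_right)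

/-- Binary meets distribute over arbitrary joins, so a witness may be fixed after strengthening the
condition; no mixing of names is needed. -/
theorem exists_elim {ι : Sort*} {f : ι → B} (h : p ≤ ⨆ i, f i)
    (hf : ∀ i, ∀ q ≤ p, q ≤ f i → q ≤ c) : p ≤ c := by
  calc p = ⨆ i, p ⊓ f i := by rw [← inf_iSup_eq, inf_eq_left.2 h]
    _ ≤ c := iSup_le fun i => hf i _ inf_le_left inf_le_right

theorem imp_intro (h : ∀ q ≤ p, q ≤ a → q ≤ b) : p ≤ a ⇨ b :=
  le_himp_iff.2 (h _ inf_le_left inf_le_right)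

theorem imp_elim (h : p ≤ a ⇨ b) (ha : p ≤ a) : p ≤ b := by
  simpa [inf_eq_left.2 ha] using le_himp_iff.1 h

theorem not_intro (h : ∀ q ≤ p, q ≤ a → q = ⊥) : p ≤ aᶜ := by
  rw [← himp_bot]
  exact imp_intro fun q hq ha => (h q hq ha).le

theorem not_elim (h : p ≤ aᶜ) (ha : p ≤ a) : p = ⊥ :=
  le_bot_iff.1 (by simpa using le_inf ha h)

theorem exists_ne_bot_of_le_iSup {ι : Sort*} {f : ι → B} (hp : p ≠ ⊥) (h : p ≤ ⨆ i, f i) :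
    ∃ i, p ⊓ f i ≠ ⊥ := by
  by_contra! H
  exact hp (le_bot_iff.1 (exists_elim h fun i q hq hi => (le_inf hq hi).trans (H i).le))

theorem le_of_forall_not_disjoint (h : ∀ q ≤ p, q ≠ ⊥ → q ⊓ a ≠ ⊥) : p ≤ a := by
  by_contra H
  refine h (p ⊓ aᶜ) inf_le_left (fun h0 => H ?_) (by simp [inf_assoc])
  rwa [← sdiff_eq, sdiff_eq_bot_iff] at h0

end Forcing

variable {B : Type u} [CompleteBooleanAlgebra B]

/-! ### Equality, membership and pairs in `V^B` -/

theorem beq_def (x y : BVSet B) : x =ᴮ y =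
    (⨅ i : x.Idx, x.val i ⇨ (x.fam i ∈ᴮ y)) ⊓
      (⨅ j : y.Idx, y.val j ⇨ (⨆ i : x.Idx, x.val i ⊓ x.fam i =ᴮ y.fam j)) := by
  cases x; cases y; rw [beq]; rfl

theorem beq_refl (x : BVSet B) : x =ᴮ x = ⊤ := by
  induction x with
  | mk ι A b ih =>
    rw [beq, eq_top_iff]
    refine le_inf (le_iInf fun i => imp_intro fun q _ hi => ?_)
      (le_iInf fun i => imp_intro fun q _ hi => ?_) <;>
    exact le_iSup_of_le i (le_inf hi (by simp [ih]))

theorem beq_symm (x y : BVSet B) : x =ᴮ y = y =ᴮ x := by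
  induction x generalizing y with
  | mk ι A b ih =>
    cases y
    simp only [beq]
    rw [inf_comm]
    simp only [ih]

theorem mem_fam (x : BVSet B) (i : x.Idx) : x.val i ≤ x.fam i ∈ᴮ x :=
  le_iSup_of_le i (le_inf le_rfl (by simp [beq_refl]))

theorem fam_mem_of_beq {p : B} {x y : BVSet B} (h : p ≤ x =ᴮ y) (i : x.Idx) (hi : p ≤ x.val i) :
    p ≤ x.fam i ∈ᴮ y := by
  rw [beq_def] at h
  exact imp_elim ((h.trans inf_le_left).trans (iInf_le _ i)) hi

theorem beq_trans {p : B} {x y z : BVSet B} (h : p ≤ x =ᴮ y) (h' : p ≤ y =ᴮ z) : p ≤ x =ᴮ z := by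
  induction x generalizing p y z with
  | mk ι A b ih =>
    have key : ∀ {p : B} {y z : BVSet B}, p ≤ mk ι A b =ᴮ y → p ≤ y =ᴮ z →
        ∀ i, ∀ q ≤ p, q ≤ b i → q ≤ A i ∈ᴮ z := by
      intro p y z h h' i q hq hi
      refine exists_elim (fam_mem_of_beq (x := mk ι A b) (hq.trans h) i hi) fun j r hr hj => ?_
      refine exists_elim (fam_mem_of_beq (hr.trans (hq.trans h')) j (hj.trans inf_le_left))
        fun k s hs hk => ?_
      exact le_iSup_of_le k (le_inf (hk.trans inf_le_left)
        (ih i (hs.trans (hj.trans inf_le_right)) (hk.trans inf_le_right)))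
    rw [beq_def]
    refine le_inf (le_iInf fun i => imp_intro fun q hq hi => key h h' i q hq hi)
      (le_iInf fun k => imp_intro fun q hq hk => ?_)
    -- This half is not an instance of `key`: the induction hypothesis covers only members of the
    -- first name, so the equalities are turned round.
    rw [beq_symm] at h'
    refine exists_elim (fam_mem_of_beq (hq.trans h') k hk) fun j r hr hj => ?_
    rw [beq_symm] at h
    refine exists_elim (fam_mem_of_beq (hr.trans (hq.trans h)) j (hj.trans inf_le_left))
        fun i s hs hi => ?_
    refine le_iSup_of_le i (le_inf (hi.trans inf_le_left) (ih i (y := y.fam j) ?_ ?_))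
    · rw [beq_symm]; exact hi.trans inf_le_right
    · rw [beq_symm]; exact hs.trans (hj.trans inf_le_right)

theorem beq_symm_le {p : B} {x y : BVSet B} (h : p ≤ x =ᴮ y) : p ≤ y =ᴮ x := by
  rwa [beq_symm]

theorem le_beq_refl {p : B} (x : BVSet B) : p ≤ x =ᴮ x := by simp [beq_refl]

theorem mem_congr_left {p : B} {x y z : BVSet B} (h : p ≤ x =ᴮ y) (hx : p ≤ x ∈ᴮ z) :
    p ≤ y ∈ᴮ z :=
  exists_elim hx fun i _ hq hi => le_iSup_of_le i (le_inf (hi.trans inf_le_left)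
    (beq_trans (beq_symm_le (hq.trans h)) (hi.trans inf_le_right)))

theorem mem_congr_right {p : B} {x y z : BVSet B} (h : p ≤ y =ᴮ z) (hx : p ≤ x ∈ᴮ y) :
    p ≤ x ∈ᴮ z :=
  exists_elim hx fun i _ hq hi =>
    mem_congr_left (beq_symm_le (hi.trans inf_le_right))
      (fam_mem_of_beq (hq.trans h) i (hi.trans inf_le_left))

theorem mem_upair (x y z : BVSet B) : z ∈ᴮ upair x y = z =ᴮ x ⊔ z =ᴮ y := by
  refine le_antisymm (iSup_le fun i => ?_) (sup_le ?_ ?_)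
  · rcases i with ⟨_ | _⟩
    · exact inf_le_right.trans le_sup_right
    · exact inf_le_right.trans le_sup_left
  · exact le_iSup_of_le (ι := ULift Bool) ⟨true⟩ (le_inf le_top le_rfl)
  · exact le_iSup_of_le (ι := ULift Bool) ⟨false⟩ (le_inf le_top le_rfl)

theorem beq_of_forall_mem {p : B} {x y : BVSet B} (h : ∀ z, ∀ q ≤ p, q ≤ z ∈ᴮ x → q ≤ z ∈ᴮ y)
    (h' : ∀ z, ∀ q ≤ p, q ≤ z ∈ᴮ y → q ≤ z ∈ᴮ x) : p ≤ x =ᴮ y := by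
  rw [beq_def]
  refine le_inf (le_iInf fun i => imp_intro fun q hq hi => h _ q hq (hi.trans (mem_fam x i)))
    (le_iInf fun j => imp_intro fun q hq hj => ?_)
  refine exists_elim (h' _ q hq (hj.trans (mem_fam y j))) fun i r hr hi => ?_
  exact le_iSup_of_le i (le_inf (hi.trans inf_le_left) (beq_symm_le (hi.trans inf_le_right)))

theorem upair_congr {p : B} {x y x' y' : BVSet B} (h : p ≤ x =ᴮ x') (h' : p ≤ y =ᴮ y') :
    p ≤ upair x y =ᴮ upair x' y' := by
  refine beq_of_forall_mem (fun z q hq hz => ?_) (fun z q hq hz => ?_) <;>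
  rw [mem_upair] at hz ⊢
  · exact or_elim hz (fun r hr hx => (beq_trans hx (hr.trans (hq.trans h))).trans le_sup_left)
      (fun r hr hx => (beq_trans hx (hr.trans (hq.trans h'))).trans le_sup_right)
  · exact or_elim hz
      (fun r hr hx => (beq_trans hx (beq_symm_le (hr.trans (hq.trans h)))).trans le_sup_left)
      (fun r hr hx => (beq_trans hx (beq_symm_le (hr.trans (hq.trans h')))).trans le_sup_right)

theorem opair_congr {p : B} {x y x' y' : BVSet B} (h : p ≤ x =ᴮ x') (h' : p ≤ y =ᴮ y') :
    p ≤ opair x y =ᴮ opair x' y' :=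
  upair_congr (upair_congr h h) (upair_congr h h')

theorem left_mem_upair {p : B} (x y : BVSet B) : p ≤ x ∈ᴮ upair x y := by
  simp [mem_upair, beq_refl]

theorem right_mem_upair {p : B} (x y : BVSet B) : p ≤ y ∈ᴮ upair x y := by
  simp [mem_upair, beq_refl]

theorem beq_of_mem_singleton {p : B} {x y : BVSet B} (h : p ≤ y ∈ᴮ upair x x) : p ≤ y =ᴮ x := by
  simpa [mem_upair] using h

theorem opair_inj_left {p : B} {x y x' y' : BVSet B} (h : p ≤ opair x y =ᴮ opair x' y') :
    p ≤ x =ᴮ x' := by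
  have h1 := mem_congr_right h (left_mem_upair (upair x x) (upair x y))
  rw [opair, mem_upair] at h1
  refine or_elim h1 (fun q _ hq => ?_) (fun q _ hq => ?_) <;>
  exact beq_symm_le (beq_of_mem_singleton (mem_congr_right (beq_symm_le hq) (left_mem_upair _ _)))

theorem opair_inj_right {p : B} {x y x' y' : BVSet B} (h : p ≤ opair x y =ᴮ opair x' y') :
    p ≤ y =ᴮ y' := by
  have key : ∀ {q : B} {x y x' y' : BVSet B}, q ≤ opair x y =ᴮ opair x' y' →
      q ≤ y =ᴮ x' ⊔ y =ᴮ y' := by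
    intro q x y x' y' h
    have h1 := mem_congr_right h (right_mem_upair (upair x x) (upair x y))
    rw [opair, mem_upair] at h1
    refine or_elim h1 (fun r _ hr => ?_) (fun r _ hr => ?_)
    · exact (beq_of_mem_singleton (mem_congr_right hr (right_mem_upair _ _))).trans le_sup_left
    · have := mem_congr_right hr (right_mem_upair x y)
      rwa [mem_upair] at this
  refine or_elim (key h) (fun q hq h1 => ?_) (fun q hq h1 => h1)
  have h2 := hq.trans h
  refine or_elim (key (beq_symm_le h2)) (fun r hr h3 => ?_) (fun r hr h3 => beq_symm_le h3)
  exact beq_trans (hr.trans h1)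
    (beq_trans (beq_symm_le (opair_inj_left (hr.trans h2))) (beq_symm_le h3))

/-! ### Canonical names of ordinals -/

/-- The canonical name of an ordinal of the ground model. -/
noncomputable def ord (B : Type u) [CompleteBooleanAlgebra B] (o : Ordinal.{u}) : BVSet B :=
  check B o.toPSet

theorem mem_ord (x : BVSet B) (o : Ordinal.{u}) :
    x ∈ᴮ ord B o = ⨆ a : Set.Iio o, x =ᴮ ord B a := by
  rw [ord, Ordinal.toPSet, check, ← (Ordinal.ToType.mk (o := o)).symm.toEquiv.iSup_comp]
  simp only [bmem, val, fam, top_inf_eq]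
  rfl

theorem ord_mem_ord {p : B} {a o : Ordinal.{u}} (h : a < o) : p ≤ ord B a ∈ᴮ ord B o := by
  rw [mem_ord]
  exact le_iSup_of_le ⟨a, h⟩ (le_beq_refl _)

theorem mem_ord_elim {p c : B} {x : BVSet B} {o : Ordinal.{u}} (h : p ≤ x ∈ᴮ ord B o)
    (hc : ∀ a < o, ∀ q ≤ p, q ≤ x =ᴮ ord B a → q ≤ c) : p ≤ c := by
  rw [mem_ord] at h
  exact exists_elim h fun a => hc a a.2

/-- If `o` equals some `a < o`, then `a ∈ o` becomes `a ∈ a`, which the induction excludes. -/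
theorem ord_mem_self (o : Ordinal.{u}) : ord B o ∈ᴮ ord B o = ⊥ := by
  induction o using WellFoundedLT.induction with
  | ind o ih =>
    refine le_bot_iff.1 (mem_ord_elim le_rfl fun a ha q hq h => ?_)
    rw [← ih a ha]
    exact mem_congr_right h (ord_mem_ord ha)

theorem ord_beq_ord {a b : Ordinal.{u}} (h : a ≠ b) : ord B a =ᴮ ord B b = ⊥ := by
  wlog hab : a < b generalizing a b
  · rw [beq_symm]
    exact this h.symm (lt_of_le_of_ne (not_lt.1 hab) h.symm)
  rw [eq_bot_iff, ← ord_mem_self b]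
  exact mem_congr_left le_rfl (ord_mem_ord hab)

theorem eq_of_ord_beq {p : B} (hp : p ≠ ⊥) {a b : Ordinal.{u}} (h : p ≤ ord B a =ᴮ ord B b) :
    a = b := by
  by_contra H
  exact hp (le_bot_iff.1 (h.trans (ord_beq_ord H).le))

theorem lt_of_ord_mem {p : B} (hp : p ≠ ⊥) {a b : Ordinal.{u}} (h : p ≤ ord B a ∈ᴮ ord B b) :
    a < b := by
  rw [mem_ord] at h
  obtain ⟨c, hc⟩ := exists_ne_bot_of_le_iSup hp h
  exact (eq_of_ord_beq hc inf_le_right).trans_lt c.2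

theorem isTransitive_congr {p : B} {x y : BVSet B} (h : p ≤ x =ᴮ y) (hx : p ≤ isTransitive x) :
    p ≤ isTransitive y :=
  le_iInf fun z => imp_intro fun q hq hz => le_iInf fun w => imp_intro fun r hr hw => by
    have h1 : r ≤ z ∈ᴮ x := mem_congr_right (beq_symm_le (hr.trans (hq.trans h))) (hr.trans hz)
    have h2 : r ≤ bsubset z x := imp_elim (((hr.trans hq).trans hx).trans (iInf_le _ z)) h1
    exact mem_congr_right ((hr.trans hq).trans h) (imp_elim (h2.trans (iInf_le _ w)) hw)

theorem isTransitive_ord {p : B} (o : Ordinal.{u}) : p ≤ isTransitive (ord B o) :=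
  le_iInf fun _ => imp_intro fun _ _ hz => le_iInf fun _ => imp_intro fun _ hr hw =>
    mem_ord_elim (hr.trans hz) fun _ ha _ hs h =>
      mem_ord_elim (mem_congr_right h (hs.trans hw)) fun _ hb _ _ h' =>
        mem_congr_left (beq_symm_le h') (ord_mem_ord (hb.trans ha))

theorem isOrdinal_ord {p : B} (o : Ordinal.{u}) : p ≤ isOrdinal (ord B o) :=
  le_inf (isTransitive_ord o) <| le_iInf fun _ => imp_intro fun _ _ hz =>
    mem_ord_elim hz fun a _ _ _ h => isTransitive_congr (beq_symm_le h) (isTransitive_ord a)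

end BVSet

/-! ### Names for functions and for sets of naturals -/

namespace BVSet

variable {B : Type u} [CompleteBooleanAlgebra B]

/-- The name of a function whose value at the ordinal `idx i` is `T i` with Boolean value `w i`. -/
noncomputable def funName {I : Type u} (idx : I → Ordinal.{u}) (T : I → BVSet B) (w : I → B) :
    BVSet B :=
  mk I (fun i => opair (ord B (idx i)) (T i)) w

section funName

variable {I : Type u} {idx : I → Ordinal.{u}} {T : I → BVSet B} {w : I → B}

theorem mem_funName_elim {p c : B} {x y : BVSet B} (h : p ≤ opair x y ∈ᴮ funName idx T w)
    (hc : ∀ i, ∀ q ≤ p, q ≤ w i → q ≤ x =ᴮ ord B (idx i) → q ≤ y =ᴮ T i → q ≤ c) : p ≤ c :=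
  exists_elim h fun i q hq hi => hc i q hq (hi.trans inf_le_left)
    (opair_inj_left (hi.trans inf_le_right)) (opair_inj_right (hi.trans inf_le_right))

theorem opair_mem_funName (i : I) : w i ≤ opair (ord B (idx i)) (T i) ∈ᴮ funName idx T w :=
  mem_fam (funName idx T w) i

theorem isFunOn_funName {p : B} {o : Ordinal.{u}} (hidx : ∀ i, idx i < o)
    (htot : ∀ a < o, ⊤ ≤ ⨆ i, ⨆ (_ : idx i = a), w i)
    (hT : ∀ i j, idx i = idx j → w i ⊓ w j ≤ T i =ᴮ T j) :
    p ≤ isFunOn (funName idx T w) (ord B o) := by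
  refine le_inf (le_inf ?_ ?_) ?_
  · refine le_iInf fun z => imp_intro fun q _ hz => ?_
    refine exists_elim hz fun i r _ hi => ?_
    exact le_iSup_of_le (ord B (idx i)) (le_iSup_of_le (T i)
      (le_inf (ord_mem_ord (hidx i)) (hi.trans inf_le_right)))
  · refine le_iInf fun x => imp_intro fun q _ hx => mem_ord_elim hx fun a ha r _ hr => ?_
    refine exists_elim (le_top.trans (htot a ha)) fun i s hs hi => ?_
    refine exists_elim hi fun hia t ht hti => ?_
    subst hia
    exact le_iSup_of_le (T i) (mem_congr_left
      (opair_congr (beq_symm_le (ht.trans (hs.trans hr))) (le_beq_refl _))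
      (hti.trans (opair_mem_funName i)))
  · refine le_iInf fun x => le_iInf fun y => le_iInf fun z => imp_intro fun q _ h => ?_
    refine mem_funName_elim (h.trans inf_le_left) fun i r hr hwi hxi hyi => ?_
    refine mem_funName_elim (hr.trans (h.trans inf_le_right)) fun j s hs hwj hxj hzj => ?_
    rcases eq_or_ne s ⊥ with rfl | hs0
    · exact bot_le
    have hij := eq_of_ord_beq hs0 (beq_trans (beq_symm_le (hs.trans hxi)) hxj)
    exact beq_trans (hs.trans hyi) (beq_trans ((le_inf (hs.trans hwi) hwj).trans (hT i j hij))
      (beq_symm_le hzj))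

end funName

/-- The canonical name of a set of natural numbers. -/
noncomputable def natName (B : Type u) [CompleteBooleanAlgebra B] (S : Set ℕ) : BVSet B :=
  mk (ULift S) (fun n => ord B (n.down : ℕ)) (fun _ => ⊤)

theorem ord_mem_natName {p : B} {S : Set ℕ} {n : ℕ} (hn : n ∈ S) : p ≤ ord B n ∈ᴮ natName B S :=
  le_iSup_of_le (ι := ULift S) ⟨⟨n, hn⟩⟩ (le_inf le_top (le_beq_refl _))

theorem mem_natName_elim {p c : B} {x : BVSet B} {S : Set ℕ} (h : p ≤ x ∈ᴮ natName B S)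
    (hc : ∀ n ∈ S, ∀ q ≤ p, q ≤ x =ᴮ ord B n → q ≤ c) : p ≤ c :=
  exists_elim h fun n q hq hn => hc _ n.down.2 q hq (hn.trans inf_le_right)

theorem mem_omega_elim {p c : B} {x : BVSet B} (h : p ≤ x ∈ᴮ omega B)
    (hc : ∀ n : ℕ, ∀ q ≤ p, q ≤ x =ᴮ ord B n → q ≤ c) : p ≤ c :=
  mem_ord_elim h fun a ha q hq hx => by
    obtain ⟨n, rfl⟩ := Ordinal.lt_omega0.1 ha
    exact hc n q hq hx

theorem nat_mem_omega {p : B} (n : ℕ) : p ≤ ord B n ∈ᴮ omega B :=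
  ord_mem_ord (Ordinal.natCast_lt_omega0 n)

theorem mem_of_ord_mem_natName {p : B} (hp : p ≠ ⊥) {S : Set ℕ} {n : ℕ}
    (h : p ≤ ord B n ∈ᴮ natName B S) : n ∈ S := by
  by_contra hn
  refine hp (le_bot_iff.1 (mem_natName_elim h fun m hm q _ hq => ?_))
  by_contra hq0
  exact hn (Nat.cast_injective (eq_of_ord_beq (mt (fun h => h.le) hq0) hq) ▸ hm)

theorem isFinite_congr {p : B} {x y : BVSet B}
    (h : ∀ z, ∀ q ≤ p, q ≤ z ∈ᴮ x → q ≤ z ∈ᴮ y) (h' : ∀ z, ∀ q ≤ p, q ≤ z ∈ᴮ y → q ≤ z ∈ᴮ x)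
    (hx : p ≤ isFinite x) : p ≤ isFinite y := by
  refine exists_elim hx fun n q hq hn => exists_elim hn fun f r hr hf => ?_
  refine le_iSup_of_le n (le_iSup_of_le f (le_inf (hf.trans inf_le_left) (le_iInf fun z => ?_)))
  have hz := (hf.trans inf_le_right).trans (iInf_le _ z)
  exact le_inf
    (imp_intro fun s hs hsy => imp_elim (hs.trans (hz.trans inf_le_left))
      (h' z s (hs.trans (hr.trans hq)) hsy))
    (imp_intro fun s hs hsf => h z s (hs.trans (hr.trans hq))
      (imp_elim (hs.trans (hz.trans inf_le_right)) hsf))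

theorem isFinite_natName {p : B} {F : Set ℕ} (hF : F.Finite) : p ≤ isFinite (natName B F) := by
  obtain ⟨n, e, rfl⟩ : ∃ (n : ℕ) (e : Fin n → ℕ), Set.range e = F := by
    have := hF.to_subtype
    obtain ⟨n, ⟨e⟩⟩ := Finite.exists_equiv_fin F
    exact ⟨n, fun i => e.symm i, by
      rw [Set.range_comp' Subtype.val e.symm, e.symm.surjective.range_eq]; simp⟩
  refine le_iSup_of_le (ord B n) (le_iSup_of_le
    (funName (I := ULift (Fin n)) (fun i => ((i.down : ℕ) : Ordinal)) (fun i => ord B (e i.down))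
      (fun _ => ⊤)) (le_inf (le_inf (nat_mem_omega n) (isFunOn_funName ?_ ?_ ?_))
        (le_iInf fun y => le_inf (imp_intro fun q _ hy => ?_) (imp_intro fun q _ hy => ?_))))
  · exact fun i => by exact_mod_cast i.down.2
  · intro a ha
    obtain ⟨m, rfl⟩ := Ordinal.lt_omega0.1 (ha.trans (Ordinal.natCast_lt_omega0 n))
    exact le_iSup_of_le ⟨⟨m, by exact_mod_cast ha⟩⟩ (le_iSup_of_le rfl le_rfl)
  · rintro ⟨i⟩ ⟨j⟩ hij
    obtain rfl : i = j := Fin.ext (by exact_mod_cast hij)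
    exact le_beq_refl _
  · refine mem_natName_elim hy fun m ⟨i, hi⟩ r _ hr => ?_
    subst hi
    refine le_iSup_of_le (ord B ((i : ℕ) : Ordinal)) (mem_congr_left
      (opair_congr (le_beq_refl _) (beq_symm_le hr)) ?_)
    exact le_top.trans (opair_mem_funName (I := ULift (Fin n))
      (idx := fun i => ((i.down : ℕ) : Ordinal)) (T := fun i => ord B (e i.down))
      (w := fun _ => ⊤) ⟨i⟩)
  · refine exists_elim hy fun x r hr hx => mem_funName_elim hx fun i s hs _ _ h => ?_
    exact mem_congr_left (beq_symm_le h) (ord_mem_natName ⟨i.down, rfl⟩)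

/-- Pigeonhole: a surjection from `k` would have to cover `k + 1` distinct members of `A`. -/
theorem eq_bot_of_isFinite_natName {p : B} {A : Set ℕ} (hA : A.Infinite)
    (h : p ≤ isFinite (natName B A)) : p = ⊥ := by
  refine le_bot_iff.1 (exists_elim h fun n q hq hn => exists_elim hn fun f r hr hf => ?_)
  refine mem_omega_elim (hf.trans (inf_le_left.trans inf_le_left)) fun k s hs hk => ?_
  obtain ⟨F, hFA, hF⟩ := hA.exists_subset_card_eq (k + 1)
  have hfun : s ≤ isFunOn f n := hs.trans (hf.trans (inf_le_left.trans inf_le_right))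
  -- Each preimage is known only after strengthening the condition; induction on `F'` gathers
  -- finitely many such choices into a ground-model function `g` below one condition.
  have key : ∀ (F' : Finset ℕ), (F' : Set ℕ) ⊆ A → ∀ c : B,
      (∀ g : ℕ → ℕ, (∀ m ∈ F', g m < k) → ∀ t ≤ s,
        (∀ m ∈ F', t ≤ opair (ord B (g m)) (ord B m) ∈ᴮ f) → t ≤ c) → s ≤ c := by
    intro F'
    induction F' using Finset.induction_on with
    | empty => exact fun _ c hc => hc (fun _ => 0) (by simp) s le_rfl (by simp)
    | insert m F' hm ih =>
      intro hF' c hc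
      rw [Finset.coe_insert, Set.insert_subset_iff] at hF'
      refine ih hF'.2 c fun g hg t ht htg => ?_
      have hex : t ≤ ⨆ i : BVSet B, opair i (ord B m) ∈ᴮ f :=
        imp_elim (ht.trans (hs.trans (hf.trans (inf_le_right.trans
          ((iInf_le _ (ord B m)).trans inf_le_left))))) (ord_mem_natName hF'.1)
      refine exists_elim hex fun i t₁ ht₁ hi => ?_
      have hdom := imp_elim ((ht₁.trans (ht.trans hfun)).trans
        (inf_le_left.trans (inf_le_left.trans (iInf_le _ (opair i (ord B m)))))) hi
      refine exists_elim hdom fun x t₂ ht₂ hx => exists_elim hx fun y t₃ ht₃ hxy => ?_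
      have hin : t₃ ≤ i ∈ᴮ ord B k := mem_congr_right
        ((ht₃.trans (ht₂.trans (ht₁.trans ht))).trans hk)
        (mem_congr_left (beq_symm_le (opair_inj_left (hxy.trans inf_le_right)))
          (hxy.trans inf_le_left))
      refine mem_ord_elim hin fun a ha t₄ ht₄ hia => ?_
      obtain ⟨l, rfl⟩ := Ordinal.lt_omega0.1 (ha.trans (Ordinal.natCast_lt_omega0 k))
      have h41 : t₄ ≤ t₁ := ht₄.trans (ht₃.trans ht₂)
      refine hc (Function.update g m l) ?_ t₄ (h41.trans (ht₁.trans ht)) ?_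
      · intro m' hm'
        rcases eq_or_ne m' m with rfl | hne
        · simpa using ha
        · simpa [hne] using hg m' ((Finset.mem_insert.1 hm').resolve_left hne)
      · intro m' hm'
        rcases eq_or_ne m' m with rfl | hne
        · simpa using mem_congr_left (opair_congr hia (le_beq_refl _)) (h41.trans hi)
        · simpa [hne] using
            (h41.trans ht₁).trans (htg m' ((Finset.mem_insert.1 hm').resolve_left hne))
  refine key F hFA ⊥ fun g hg t ht htg => ?_
  obtain ⟨a, ha, b, hb, hab, hgab⟩ := Finset.exists_ne_map_eq_of_card_lt_of_maps_to
    (t := Finset.range k) (by simp [hF]) (fun m hm => Finset.mem_range.2 (hg m hm))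
  have heq : t ≤ ord B a =ᴮ ord B b := by
    refine imp_elim ((ht.trans hfun).trans (inf_le_right.trans
      ((iInf_le _ (ord B (g a))).trans ((iInf_le _ (ord B a)).trans (iInf_le _ (ord B b))))))
      (le_inf (htg a ha) ?_)
    rw [hgab]
    exact htg b hb
  exact heq.trans (ord_beq_ord (by exact_mod_cast hab)).le

theorem finite_of_isFinite_natName {p : B} (hp : p ≠ ⊥) {A : Set ℕ}
    (h : p ≤ isFinite (natName B A)) : A.Finite := by
  by_contra hA
  exact hp (eq_bot_of_isFinite_natName hA h)

theorem mem_diff_intro {p : B} {x y z : BVSet B} (h : p ≤ z ∈ᴮ x) (h' : p ≤ (z ∈ᴮ y)ᶜ) :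
    p ≤ z ∈ᴮ diff x y := by
  refine exists_elim h fun i q hq hi => le_iSup_of_le (ι := x.Idx) i (le_inf (le_inf
    (hi.trans inf_le_left) ?_) (hi.trans inf_le_right))
  exact not_intro fun r hr hri => not_elim (hr.trans (hq.trans h'))
    (mem_congr_left (beq_symm_le (hr.trans (hi.trans inf_le_right))) hri)

theorem mem_of_mem_diff {p : B} {x y z : BVSet B} (h : p ≤ z ∈ᴮ diff x y) : p ≤ z ∈ᴮ x :=
  exists_elim h fun i _ _ hi => le_iSup_of_le (ι := x.Idx) i
    (le_inf (hi.trans (inf_le_left.trans inf_le_left)) (hi.trans inf_le_right))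

theorem not_mem_of_mem_diff {p : B} {x y z : BVSet B} (h : p ≤ z ∈ᴮ diff x y) :
    p ≤ (z ∈ᴮ y)ᶜ :=
  exists_elim h fun _ _ _ hi => not_intro fun _ hr hz =>
    not_elim (hr.trans (hi.trans (inf_le_left.trans inf_le_right)))
      (mem_congr_left (hr.trans (hi.trans inf_le_right)) hz)

theorem diff_congr {p : B} {x y x' y' z : BVSet B} (hx : ∀ q ≤ p, q ≤ z ∈ᴮ x → q ≤ z ∈ᴮ x')
    (hy : ∀ q ≤ p, q ≤ z ∈ᴮ y' → q ≤ z ∈ᴮ y) (h : p ≤ z ∈ᴮ diff x y) : p ≤ z ∈ᴮ diff x' y' :=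
  mem_diff_intro (hx p le_rfl (mem_of_mem_diff h))
    (not_intro fun q hq hz => not_elim (hq.trans (not_mem_of_mem_diff h)) (hy q hq hz))

theorem almostSubset_congr {p : B} {x y x' y' : BVSet B}
    (hx : ∀ z, ∀ q ≤ p, q ≤ z ∈ᴮ x → q ≤ z ∈ᴮ x') (hx' : ∀ z, ∀ q ≤ p, q ≤ z ∈ᴮ x' → q ≤ z ∈ᴮ x)
    (hy : ∀ z, ∀ q ≤ p, q ≤ z ∈ᴮ y → q ≤ z ∈ᴮ y') (hy' : ∀ z, ∀ q ≤ p, q ≤ z ∈ᴮ y' → q ≤ z ∈ᴮ y)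
    (h : p ≤ almostSubset x y) : p ≤ almostSubset x' y' :=
  isFinite_congr
    (fun z _ hq => diff_congr (fun r hr => hx z r (hr.trans hq)) fun r hr => hy' z r (hr.trans hq))
    (fun z _ hq => diff_congr (fun r hr => hx' z r (hr.trans hq)) fun r hr => hy z r (hr.trans hq))
    h

theorem mem_natName_diff {p : B} {z : BVSet B} {S T : Set ℕ} (h : p ≤ z ∈ᴮ natName B (S \ T)) :
    p ≤ z ∈ᴮ diff (natName B S) (natName B T) :=
  mem_natName_elim h fun n hn q _ hz => mem_diff_intro
    (mem_congr_left (beq_symm_le hz) (ord_mem_natName hn.1))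
    (not_intro fun r hr hr' => by
      by_contra hr0
      exact hn.2 (mem_of_ord_mem_natName hr0 (mem_congr_left (hr.trans hz) hr')))

theorem mem_diff_natName {p : B} {z : BVSet B} {S T : Set ℕ}
    (h : p ≤ z ∈ᴮ diff (natName B S) (natName B T)) : p ≤ z ∈ᴮ natName B (S \ T) :=
  mem_natName_elim (mem_of_mem_diff h) fun n hn q hq hz => by
    by_cases hnT : n ∈ T
    · exact (not_elim (hq.trans (not_mem_of_mem_diff h))
        (mem_congr_left (beq_symm_le hz) (ord_mem_natName hnT))).le.trans bot_le
    · exact mem_congr_left (beq_symm_le hz) (ord_mem_natName ⟨hn, hnT⟩)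

theorem almostSubset_natName {p : B} {S T : Set ℕ} (h : (S \ T).Finite) :
    p ≤ almostSubset (natName B S) (natName B T) :=
  isFinite_congr (fun _ _ _ => mem_natName_diff) (fun _ _ _ => mem_diff_natName)
    (isFinite_natName h)

theorem finite_of_almostSubset_natName {p : B} (hp : p ≠ ⊥) {S T : Set ℕ}
    (h : p ≤ almostSubset (natName B S) (natName B T)) : (S \ T).Finite :=
  finite_of_isFinite_natName hp
    (isFinite_congr (fun _ _ _ => mem_diff_natName) (fun _ _ _ => mem_natName_diff) h)

theorem isInfSubsetOmega_of_beq_natName {p : B} {x : BVSet B} {S : Set ℕ} (hS : S.Infinite)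
    (h : p ≤ x =ᴮ natName B S) : p ≤ isInfSubsetOmega x := by
  refine le_inf (le_iInf fun z => imp_intro fun q hq hz => ?_) (not_intro fun q hq hx => ?_)
  · exact mem_natName_elim (mem_congr_right (hq.trans h) hz) fun n _ _ _ hzn =>
      mem_congr_left (beq_symm_le hzn) (nat_mem_omega n)
  · exact eq_bot_of_isFinite_natName hS (isFinite_congr
      (fun _ _ hr => mem_congr_right (hr.trans (hq.trans h)))
      (fun _ _ hr => mem_congr_right (beq_symm_le (hr.trans (hq.trans h)))) hx)

end BVSet

/-! ### Distributivity as deciding families densely often -/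

theorem isDistributive_two_iff {B : Type u} [CompleteBooleanAlgebra B] {o : Ordinal.{u}} :
    IsDistributive B o 2 ↔ ∀ u : Set.Iio o → B, ∀ p : B, p ≠ ⊥ →
      ∃ q ≤ p, q ≠ ⊥ ∧ ∃ A : Set (Set.Iio o), (∀ a ∈ A, q ≤ u a) ∧ ∀ a ∉ A, q ≤ (u a)ᶜ := by
  classical
  let zero : Set.Iio (2 : Ordinal.{u}) := ⟨0, by simp⟩
  let one : Set.Iio (2 : Ordinal.{u}) := ⟨1, by simp⟩
  have h01 : one ≠ zero := by simp [zero, one, Subtype.ext_iff]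
  have hcases : ∀ b : Set.Iio (2 : Ordinal.{u}), b = zero ∨ b = one := by
    rintro ⟨b, hb⟩
    rw [Set.mem_Iio, ← one_add_one_eq_two, ← Order.succ_eq_add_one, Order.lt_succ_iff,
      Order.le_one_iff] at hb
    simpa [zero, one, Subtype.ext_iff] using hb
  constructor
  · intro h u p hp
    have h1 := h fun a b => if b = zero then u a else (u a)ᶜ
    have h2 : p ≤ ⨅ a, ⨆ b, if b = zero then u a else (u a)ᶜ := by
      refine le_iInf fun a => le_top.trans ?_
      rw [← sup_compl_eq_top (x := u a)]
      exact sup_le (le_iSup_of_le zero (by simp)) (le_iSup_of_le one (by simp [h01]))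
    rw [h1] at h2
    obtain ⟨f, hf⟩ := BVSet.exists_ne_bot_of_le_iSup hp h2
    refine ⟨_, inf_le_left, hf, {a | f a = zero}, fun a ha => ?_, fun a ha => ?_⟩ <;>
    refine inf_le_right.trans ((iInf_le _ a).trans ?_) <;>
    rw [Set.mem_ofPred_eq] at ha <;>
    simp [ha]
  · intro h v
    refine le_antisymm ?_ (iSup_le fun f => le_iInf fun a => (iInf_le _ a).trans
      (le_iSup (v a) (f a)))
    refine BVSet.le_of_forall_not_disjoint fun p hp hp0 => ?_
    -- Deciding column zero suffices: where it fails, the join over both columns forces column one.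
    obtain ⟨q, hqp, hq0, A, hA, hA'⟩ := h (fun a => v a zero) p hp0
    refine mt (fun h => ?_) hq0
    rw [← le_bot_iff, ← h]
    refine le_inf hqp (le_iSup_of_le (fun a => if a ∈ A then zero else one) (le_iInf fun a => ?_))
    by_cases ha : a ∈ A
    · simpa [ha] using hA a ha
    · simp only [ha, if_false]
      refine BVSet.exists_elim (hqp.trans (hp.trans (iInf_le _ a))) fun b r hr hb => ?_
      rcases hcases b with rfl | rfl
      · exact (BVSet.not_elim (hr.trans (hA' a ha)) hb).le.trans bot_le
      · exact hb

theorem IsDistributive.exists_set_nat {B : Type u} [CompleteBooleanAlgebra B]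
    (h : IsDistributive B Ordinal.omega0 2) (v : ℕ → B) {p : B} (hp : p ≠ ⊥) :
    ∃ q ≤ p, q ≠ ⊥ ∧ ∃ A : Set ℕ, (∀ n ∈ A, q ≤ v n) ∧ ∀ n ∉ A, q ≤ (v n)ᶜ := by
  choose e he using fun a : Set.Iio Ordinal.omega0.{u} => Ordinal.lt_omega0.1 a.2
  have he' : ∀ n : ℕ, e ⟨n, Ordinal.natCast_lt_omega0 n⟩ = n := fun n =>
    Nat.cast_injective (R := Ordinal.{u}) (he ⟨n, Ordinal.natCast_lt_omega0 n⟩).symm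
  obtain ⟨q, hqp, hq0, A, hA, hA'⟩ := isDistributive_two_iff.1 h (fun a => v (e a)) p hp
  refine ⟨q, hqp, hq0, {n | ⟨n, Ordinal.natCast_lt_omega0 n⟩ ∈ A}, fun n hn => ?_, fun n hn => ?_⟩
  · simpa only [he'] using hA _ hn
  · simpa only [he'] using hA' _ hn

/-! ### Pseudo-intersections of sequences shorter than `𝔱` -/

namespace BVSet

variable {B : Type u} [CompleteBooleanAlgebra B]

/-- On the part of `1` where `s` has no pseudo-intersection, `o` is a tower length, so `𝔱 ≤ o ≤ κ`
there, against `κ ∈ 𝔱`; that part is therefore `⊥`. -/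
theorem hasPseudoIntersection_of_le {κ o : Ordinal.{u}} (hκ : ⊤ ≤ ltTowerNumber (ord B κ))
    (ho : o ≤ κ) {s : BVSet B} (hs : ⊤ ≤ isDecreasingSeq s (ord B o)) :
    ⊤ ≤ hasPseudoIntersection s := by
  refine exists_elim hκ fun t q _ hq => ?_
  refine or_elim (le_top.trans (sup_compl_eq_top (x := hasPseudoIntersection s)).ge)
    (fun _ _ h => h) fun r hr hns => ?_
  have hlen : r ≤ isTowerLength (ord B o) :=
    le_inf (isOrdinal_ord o) (le_iSup_of_le s (le_inf (le_top.trans hs) hns))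
  have hmem : r ≤ ord B κ ∈ᴮ t := hr.trans (hq.trans inf_le_right)
  have hmin := imp_elim (hr.trans (hq.trans (inf_le_left.trans
    (inf_le_right.trans (iInf_le _ (ord B o)))))) hlen
  refine or_elim hmin (fun r' hr' h => ?_) fun r' hr' h => ?_
  · by_contra hne
    exact ho.not_gt (lt_of_ord_mem (mt (fun h => h.le.trans bot_le) hne)
      (mem_congr_right h (hr'.trans hmem)))
  · refine mem_ord_elim h fun a ha r'' hr'' h' => ?_
    by_contra hne
    exact (ha.trans_le ho).not_gt (lt_of_ord_mem (mt (fun h => h.le.trans bot_le) hne)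
      (mem_congr_right h' (hr''.trans (hr'.trans hmem))))

theorem isDecreasingSeq_funName {I : Type u} {o : Ordinal.{u}} {idx : I → Ordinal.{u}}
    {S : I → Set ℕ} {w : I → B} (hidx : ∀ i, idx i < o)
    (htot : ∀ a < o, ⊤ ≤ ⨆ i, ⨆ (_ : idx i = a), w i) (hinf : ∀ i, (S i).Infinite)
    (heq : ∀ i j, idx i = idx j → w i ⊓ w j ≠ ⊥ → S i = S j)
    (hlt : ∀ i j, idx i < idx j → w i ⊓ w j ≠ ⊥ → (S j \ S i).Finite) {p : B} :
    p ≤ isDecreasingSeq (funName idx (fun i => natName B (S i)) w) (ord B o) := by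
  refine le_inf (le_inf (isFunOn_funName hidx htot fun i j hij => ?_) ?_) ?_
  · by_cases h : w i ⊓ w j = ⊥
    · simp [h]
    · rw [heq i j hij h]
      exact le_beq_refl _
  · exact le_iInf fun x => le_iInf fun y => imp_intro fun q _ hq =>
      mem_funName_elim hq fun i r _ _ _ hy => isInfSubsetOmega_of_beq_natName (hinf i) hy
  · refine le_iInf fun x => le_iInf fun y => le_iInf fun X => le_iInf fun Y =>
      imp_intro fun q _ hq => ?_
    have hxy : q ≤ x ∈ᴮ y := hq.trans (inf_le_left.trans inf_le_left)
    refine mem_funName_elim (hq.trans (inf_le_left.trans inf_le_right)) fun i r hr hwi hx hX => ?_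
    refine mem_funName_elim (hr.trans (hq.trans inf_le_right)) fun j t ht hwj hy hY => ?_
    by_cases ht0 : t = ⊥
    · simp [ht0]
    have hij := lt_of_ord_mem ht0 (mem_congr_left (ht.trans hx)
      (mem_congr_right hy (ht.trans (hr.trans hxy))))
    have hfin := hlt i j hij fun h => ht0 (le_bot_iff.1 (h ▸ le_inf (ht.trans hwi) hwj))
    exact almostSubset_congr (fun z s hs => mem_congr_right (beq_symm_le (hs.trans hY)))
      (fun z s hs => mem_congr_right (hs.trans hY))
      (fun z s hs => mem_congr_right (beq_symm_le (hs.trans (ht.trans hX))))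
      (fun z s hs => mem_congr_right (hs.trans (ht.trans hX))) (almostSubset_natName hfin)

/-- Apply `(ω,2)`-distributivity to the Boolean values of `n ∈ X`. -/
theorem exists_eq_natName (hdist : IsDistributive B Ordinal.omega0 2) {p : B} (hp : p ≠ ⊥)
    {X : BVSet B} (hX : p ≤ bsubset X (omega B)) :
    ∃ q ≤ p, q ≠ ⊥ ∧ ∃ A : Set ℕ, q ≤ X =ᴮ natName B A := by
  obtain ⟨q, hqp, hq0, A, hA, hA'⟩ := hdist.exists_set_nat (fun n => ord B (n : ℕ) ∈ᴮ X) hp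
  refine ⟨q, hqp, hq0, A, beq_of_forall_mem (fun z r hr hz => ?_) fun z r hr hz => ?_⟩
  · refine mem_omega_elim (imp_elim (hr.trans (hqp.trans (hX.trans (iInf_le _ z)))) hz)
      fun n t ht hn => ?_
    by_cases hnA : n ∈ A
    · exact mem_congr_left (beq_symm_le hn) (ord_mem_natName hnA)
    · exact (not_elim (ht.trans (hr.trans (hA' n hnA)))
        (mem_congr_left hn (ht.trans hz))).le.trans bot_le
  · exact mem_natName_elim hz fun n hn t ht htn =>
      mem_congr_left (beq_symm_le htn) (ht.trans (hr.trans (hA n hn)))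

/-- Below any condition, a decreasing sequence in `V^B` of length less than `𝔱` whose terms are
sets of the ground model has a pseudo-intersection that lies in the ground model. -/
theorem exists_infinite_almost_subset (hdist : IsDistributive B Ordinal.omega0 2)
    {κ o : Ordinal.{u}} (hκ : ⊤ ≤ ltTowerNumber (ord B κ)) (ho : o ≤ κ)
    {I : Type u} {idx : I → Ordinal.{u}}
    {S : I → Set ℕ} {w : I → B} (hidx : ∀ i, idx i < o)
    (htot : ∀ a < o, ⊤ ≤ ⨆ i, ⨆ (_ : idx i = a), w i) (hinf : ∀ i, (S i).Infinite)
    (heq : ∀ i j, idx i = idx j → w i ⊓ w j ≠ ⊥ → S i = S j)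
    (hlt : ∀ i j, idx i < idx j → w i ⊓ w j ≠ ⊥ → (S j \ S i).Finite) {p : B} (hp : p ≠ ⊥) :
    ∃ q ≤ p, q ≠ ⊥ ∧ ∃ A : Set ℕ, A.Infinite ∧ ∀ i, q ⊓ w i ≠ ⊥ → (A \ S i).Finite := by
  have hPI := hasPseudoIntersection_of_le hκ ho
    (isDecreasingSeq_funName hidx htot hinf heq hlt)
  obtain ⟨X, hX⟩ := exists_ne_bot_of_le_iSup hp (le_top.trans hPI)
  obtain ⟨q, hq, hq0, A, hA⟩ := exists_eq_natName hdist hX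
    (inf_le_right.trans (inf_le_left.trans inf_le_left))
  refine ⟨q, hq.trans inf_le_left, hq0, A, fun hAfin => hq0 ?_, fun i hi => ?_⟩
  · exact not_elim (hq.trans (inf_le_right.trans (inf_le_left.trans inf_le_right)))
      (isFinite_congr (fun _ _ hr => mem_congr_right (beq_symm_le (hr.trans hA)))
        (fun _ _ hr => mem_congr_right (hr.trans hA)) (isFinite_natName hAfin))
  · have h := imp_elim (inf_le_left.trans (hq.trans (inf_le_right.trans (inf_le_right.trans
      ((iInf_le _ (ord B (idx i))).trans (iInf_le _ (natName B (S i))))))))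
      (inf_le_right.trans (opair_mem_funName i) : q ⊓ w i ≤ _)
    exact finite_of_almostSubset_natName hi (almostSubset_congr
      (fun _ _ hr => mem_congr_right (hr.trans (inf_le_left.trans hA)))
      (fun _ _ hr => mem_congr_right (beq_symm_le (hr.trans (inf_le_left.trans hA))))
      (fun _ _ _ h => h) (fun _ _ _ h => h) h)

end BVSet

/-! ### The tree of infinite sets -/

/-- For infinite `S`, the sets `halve false S` and `halve true S` are two disjoint infinite subsets
of `S`. -/
noncomputable def halve (b : Bool) (S : Set ℕ) : Set ℕ :=
  Set.range fun k => Nat.nth (· ∈ S) (2 * k + b.toNat)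

theorem halve_subset {b : Bool} {S : Set ℕ} (hS : S.Infinite) : halve b S ⊆ S := by
  rintro _ ⟨k, rfl⟩
  exact Nat.nth_mem_of_infinite hS _

theorem halve_infinite {b : Bool} {S : Set ℕ} (hS : S.Infinite) : (halve b S).Infinite :=
  Set.infinite_range_of_injective ((Nat.nth_injective hS).comp fun _ _ h => by simpa using h)

theorem eq_of_mem_halve {b c : Bool} {S : Set ℕ} (hS : S.Infinite) {n : ℕ} (hb : n ∈ halve b S)
    (hc : n ∈ halve c S) : b = c := by
  obtain ⟨k, rfl⟩ := hb
  obtain ⟨l, hl⟩ := hc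
  have := Nat.nth_injective hS hl
  cases b <;> cases c <;> simp at this ⊢ <;> omega

/-- The set attached to the node `h ↾ a` of a tree of infinite sets ordered by `⊇*`: an infinite set
that is almost contained in the sets attached to the nodes `h ↾ (b + 1)` for `b < a`. -/
noncomputable def branchSet (h : Ordinal.{u} → Bool) (a : Ordinal.{u}) : Set ℕ :=
  -- The choice is junk if no such `A` exists; `branchSet_spec` rules this out for `a ≤ κ`.
  Classical.epsilon fun A : Set ℕ =>
    A.Infinite ∧ ∀ b, ∀ _ : b < a, (A \ halve (h b) (branchSet h b)).Finite
termination_by a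

/-- The set attached to the node `h ↾ (a + 1)` of the tree. -/
noncomputable def nodeSet (h : Ordinal.{u} → Bool) (a : Ordinal.{u}) : Set ℕ :=
  halve (h a) (branchSet h a)

theorem branchSet_def (h : Ordinal.{u} → Bool) (a : Ordinal.{u}) :
    branchSet h a = Classical.epsilon fun A : Set ℕ =>
      A.Infinite ∧ ∀ b < a, (A \ nodeSet h b).Finite := by
  rw [branchSet]
  rfl

/-- This makes the sets a tree: equal histories pose the same choice problem, and `epsilon` answers
it equally. -/
theorem branchSet_congr {h h' : Ordinal.{u} → Bool} {a : Ordinal.{u}}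
    (hh : ∀ b < a, h b = h' b) : branchSet h a = branchSet h' a := by
  induction a using WellFoundedLT.induction with
  | ind a ih =>
    have : ∀ b < a, nodeSet h b = nodeSet h' b := fun b hb => by
      rw [nodeSet, nodeSet, hh b hb, ih b hb fun c hc => hh c (hc.trans hb)]
    rw [branchSet_def, branchSet_def]
    congr 1
    ext A
    exact and_congr_right fun _ => forall₂_congr fun b hb => by rw [this b hb]

theorem nodeSet_congr {h h' : Ordinal.{u} → Bool} {a : Ordinal.{u}}
    (hh : ∀ b ≤ a, h b = h' b) : nodeSet h a = nodeSet h' a := by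
  rw [nodeSet, nodeSet, hh a le_rfl, branchSet_congr fun b hb => hh b hb.le]

theorem finite_diff_trans {S T U : Set ℕ} (h : (S \ T).Finite) (h' : (T \ U).Finite) :
    (S \ U).Finite :=
  (h.union h').subset fun n hn => by
    by_cases hT : n ∈ T
    · exact Or.inr ⟨hT, hn.2⟩
    · exact Or.inl ⟨hn.1, hT⟩

/-! ### The named branch and its decision -/

section Tower

variable {B : Type u} [CompleteBooleanAlgebra B] {κ : Ordinal.{u}}

theorem branchSet_spec [Nontrivial B] (hdist : IsDistributive B Ordinal.omega0 2)
    (hκ : ⊤ ≤ BVSet.ltTowerNumber (BVSet.ord B κ)) (h : Ordinal.{u} → Bool) {a : Ordinal.{u}}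
    (ha : a ≤ κ) :
    (branchSet h a).Infinite ∧ ∀ b < a, (branchSet h a \ nodeSet h b).Finite := by
  induction a using WellFoundedLT.induction with
  | ind a ih =>
    rw [branchSet_def]
    apply Classical.epsilon_spec (p := fun A : Set ℕ =>
      A.Infinite ∧ ∀ b < a, (A \ nodeSet h b).Finite)
    -- With all weights `⊤` this is the name of a ground-model sequence, so every term is compatible
    -- with `q`.
    obtain ⟨q, -, hq, A, hA, hAS⟩ := BVSet.exists_infinite_almost_subset (B := B) hdist hκ ha
      (I := a.ToType) (idx := fun i => i.toOrd) (S := fun i => nodeSet h i.toOrd) (w := fun _ => ⊤)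
      (fun i => i.toOrd.2)
      (fun b hb => le_iSup_of_le (Ordinal.ToType.mk ⟨b, hb⟩) (le_iSup_of_le (by simp) le_rfl))
      (fun i => halve_infinite (ih _ i.toOrd.2 ((Set.mem_Iio.1 i.toOrd.2).le.trans ha)).1)
      (fun i j hij _ => by rw [hij])
      (fun i j hij _ => by
        have hj := ih _ j.toOrd.2 ((Set.mem_Iio.1 j.toOrd.2).le.trans ha)
        exact (hj.2 _ hij).subset (Set.sdiff_subset_sdiff_left (halve_subset hj.1)))
      (p := ⊤) top_ne_bot
    refine ⟨A, hA, fun b hb => ?_⟩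
    simpa using hAS (Ordinal.ToType.mk ⟨b, hb⟩) (by simpa using hq)

theorem nodeSet_diff_finite [Nontrivial B] (hdist : IsDistributive B Ordinal.omega0 2)
    (hκ : ⊤ ≤ BVSet.ltTowerNumber (BVSet.ord B κ)) (h : Ordinal.{u} → Bool) {a b : Ordinal.{u}}
    (ha : a ≤ κ) (hb : b ≤ a) : (nodeSet h a \ nodeSet h b).Finite := by
  rcases hb.eq_or_lt with rfl | hb
  · simp
  · have hs := branchSet_spec hdist hκ h ha
    exact (hs.2 b hb).subset (Set.sdiff_subset_sdiff_left (halve_subset hs.1))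

/-- At a first disagreement the two branches share the branch set but take disjoint halves of it,
and the infinite set `A` would be almost contained in both. -/
theorem eq_of_almost_subset_nodeSet [Nontrivial B] (hdist : IsDistributive B Ordinal.omega0 2)
    (hκ : ⊤ ≤ BVSet.ltTowerNumber (BVSet.ord B κ)) {h h' : Ordinal.{u} → Bool} {a b : Ordinal.{u}}
    (ha : a ≤ κ) {A : Set ℕ} (hA : A.Infinite) (hAh : (A \ nodeSet h a).Finite)
    (hAh' : (A \ nodeSet h' a).Finite) (hb : b ≤ a) : h b = h' b := by
  induction b using WellFoundedLT.induction with
  | ind b ih =>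
    have h1 := finite_diff_trans hAh (nodeSet_diff_finite hdist hκ h ha hb)
    have h2 := finite_diff_trans hAh' (nodeSet_diff_finite hdist hκ h' ha hb)
    obtain ⟨n, hnA, hn⟩ := hA.exists_notMem_finite (h1.union h2)
    have hn1 : n ∈ nodeSet h b := by
      by_contra hn1
      exact hn (Or.inl ⟨hnA, hn1⟩)
    have hn2 : n ∈ nodeSet h' b := by
      by_contra hn2
      exact hn (Or.inr ⟨hnA, hn2⟩)
    rw [nodeSet, ← branchSet_congr fun c hc => ih c hc (hc.le.trans hb)] at hn2
    exact eq_of_mem_halve (branchSet_spec hdist hκ h (hb.trans ha)).1 hn1 hn2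

/-- `a` or its complement. -/
def literal (a : B) (b : Bool) : B := bif b then a else aᶜ

theorem literal_disjoint {a : B} {b c : Bool} (h : b ≠ c) : literal a b ⊓ literal a c = ⊥ := by
  cases b <;> cases c <;> simp [literal] at h ⊢

/-- The node set at level `a` depends on the choice made at `a` itself, so one coordinate beyond
those below `a` is needed. -/
theorem exists_decided_le {v : Ordinal.{u} → B} {a : Ordinal.{u}} {p : B} (hp : p ≠ ⊥)
    {h : Ordinal.{u} → Bool} (hph : ∀ b < a, p ≤ literal (v b) (h b)) :
    ∃ q ≤ p, q ≠ ⊥ ∧ ∃ h' : Ordinal.{u} → Bool, ∀ b ≤ a, q ≤ literal (v b) (h' b) := by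
  obtain ⟨c, hc⟩ : ∃ c, p ⊓ literal (v a) c ≠ ⊥ := by
    refine BVSet.exists_ne_bot_of_le_iSup hp (le_top.trans ?_)
    rw [← sup_compl_eq_top (x := v a)]
    exact sup_le (le_iSup_of_le true (by simp [literal])) (le_iSup_of_le false (by simp [literal]))
  refine ⟨_, inf_le_left, hc, Function.update h a c, fun b hb => ?_⟩
  rcases hb.eq_or_lt with rfl | hb
  · simp
  · simpa [hb.ne] using inf_le_left.trans (hph b hb)

/-- The induction hypothesis makes the name of the sequence of node sets total on `o`; its
pseudo-intersection then decides the branch. -/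
theorem exists_decided [Nontrivial B] (hdist : IsDistributive B Ordinal.omega0 2)
    (hκ : ⊤ ≤ BVSet.ltTowerNumber (BVSet.ord B κ)) {o : Ordinal.{u}} (ho : o ≤ κ)
    (v : Ordinal.{u} → B) {p : B} (hp : p ≠ ⊥) :
    ∃ q ≤ p, q ≠ ⊥ ∧ ∃ h : Ordinal.{u} → Bool, ∀ b < o, q ≤ literal (v b) (h b) := by
  induction o using WellFoundedLT.induction generalizing p with
  | ind o ih =>
    -- The default `false` is never read: only coordinates up to `idx i < o` matter.
    let ext : (o.ToType → Bool) → Ordinal.{u} → Bool := fun g b =>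
      if hb : b < o then g (Ordinal.ToType.mk ⟨b, hb⟩) else false
    -- An index is a level with a candidate branch, and `w` is the Boolean value that the candidate
    -- is right up to and including that level. Many indices name the same node.
    let idx : o.ToType × (o.ToType → Bool) → Ordinal.{u} := fun i => i.1.toOrd
    let w : o.ToType × (o.ToType → Bool) → B := fun i =>
      ⨅ b, ⨅ _ : b ≤ idx i, literal (v b) (ext i.2 b)
    have hidx : ∀ i, idx i < o := fun i => i.1.toOrd.2
    have hw : ∀ i, ∀ b ≤ idx i, w i ≤ literal (v b) (ext i.2 b) := fun i b hb =>
      iInf₂_le (f := fun b (_ : b ≤ idx i) => literal (v b) (ext i.2 b)) b hb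
    have hcompat : ∀ i j, w i ⊓ w j ≠ ⊥ → ∀ b ≤ idx i, b ≤ idx j → ext i.2 b = ext j.2 b := by
      intro i j hij b hbi hbj
      by_contra hne
      refine hij (le_bot_iff.1 ?_)
      rw [← literal_disjoint (a := v b) hne]
      exact inf_le_inf (hw i b hbi) (hw j b hbj)
    have htot : ∀ a < o, ⊤ ≤ ⨆ i, ⨆ (_ : idx i = a), w i := by
      refine fun a ha => BVSet.le_of_forall_not_disjoint fun p _ hp => ?_
      obtain ⟨q, hqp, hq, h, hqh⟩ := ih a ha (ha.le.trans ho) hp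
      obtain ⟨r, hrq, hr, h', hrh'⟩ := exists_decided_le hq hqh
      refine mt (fun h => ?_) hr
      rw [← le_bot_iff, ← h]
      refine le_inf (hrq.trans hqp) (le_iSup_of_le
        (Ordinal.ToType.mk ⟨a, ha⟩, fun x => h' x.toOrd) (le_iSup_of_le (by simp [idx])
          (le_iInf₂ fun b hb => ?_)))
      have hb' : b ≤ a := by simpa [idx] using hb
      simpa [ext, hb'.trans_lt ha] using hrh' b hb'
    obtain ⟨q, hqp, hq, A, hA, hAS⟩ := BVSet.exists_infinite_almost_subset hdist hκ ho hidx
      (S := fun i => nodeSet (ext i.2) (idx i)) htot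
      (fun i => halve_infinite (branchSet_spec hdist hκ _ ((hidx i).le.trans ho)).1)
      (fun i j hij hne => by
        rw [← hij]
        exact nodeSet_congr fun b hb => hcompat i j hne b hb (hij ▸ hb))
      (fun i j hij hne => by
        rw [nodeSet_congr (h := ext i.2) fun b hb => hcompat i j hne b hb (hb.trans hij.le)]
        exact nodeSet_diff_finite hdist hκ _ ((hidx j).le.trans ho) hij.le) hp
    have hdec : ∀ a, ∃ c, a < o → q ≤ literal (v a) c := by
      intro a
      by_cases ha : a < o
      swap
      · exact ⟨false, fun h => (ha h).elim⟩
      obtain ⟨i, hi⟩ := BVSet.exists_ne_bot_of_le_iSup hq (le_top.trans (htot a ha))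
      obtain rfl : idx i = a := by
        by_contra hne
        simp [hne] at hi
      -- One index `i` compatible with `q` supplies the value. Any part of `q` lies below indices
      -- `j` of the same level, and `A` is almost contained in the sets of both `i` and `j`, so they
      -- agree there.
      refine ⟨ext i.2 (idx i), fun _ => ?_⟩
      refine BVSet.exists_elim (le_top.trans (htot _ ha)) fun j r hr hj =>
        BVSet.exists_elim hj fun hji s hs hsj => ?_
      by_cases hs0 : s = ⊥
      · simp [hs0]
      have h1 := hAS i (by simpa using hi)
      have h2 := hAS j fun h => hs0 (le_bot_iff.1 (h ▸ le_inf (hs.trans hr) hsj))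
      rw [hji] at h2
      rw [eq_of_almost_subset_nodeSet hdist hκ (ha.le.trans ho) hA h1 h2 le_rfl]
      exact hsj.trans (hw j _ hji.ge)
    choose h hh using hdec
    exact ⟨q, hqp, hq, h, hh⟩

end Tower

theorem mainTheorem4 (B : Type u) [CompleteBooleanAlgebra B] (κ : Cardinal.{u})
    (hκ : Cardinal.aleph0 ≤ κ)
    (hdist : IsDistributive B Ordinal.omega0 2)
    (hforce : BVSet.Forces (⊤ : B)
      (BVSet.ltTowerNumber (BVSet.check B (Ordinal.toPSet κ.ord)))) :
    IsDistributive B κ.ord 2 := by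
  classical
  refine isDistributive_two_iff.2 fun v p hp => ?_
  have : Nontrivial B := ⟨p, ⊥, hp⟩
  obtain ⟨q, hqp, hq, h, hqh⟩ := exists_decided hdist hforce le_rfl
    (fun a => if ha : a < κ.ord then v ⟨a, ha⟩ else ⊥) hp
  refine ⟨q, hqp, hq, {a | h a = true}, fun a ha => ?_, fun a ha => ?_⟩ <;>
  have h1 := hqh a a.2 <;>
  rw [Set.mem_ofPred_eq] at ha <;>
  simpa [literal, ha, Set.mem_Iio.1 a.2] using h1
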